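/- Let $0<\gamma<\beta<1/2$ and put $\alpha=\beta+\gamma-2\beta\gamma$. **Max 3-AND.** A formula consists of $n$ Boolean variables and a sequence of $m$ clauses $l_1\wedge l_2\wedge l_3$, each $l_i$ being a variable or its negation. An assignment is $\gamma$-biased if at most a fraction $\gamma$ of the variables is assigned $0$; a formula is $t$-satisfiable under $\gamma$-biased assignments if some $\gamma$-biased assignment satisfies at least a fraction $t$ of its clauses. A random formula with imbalance $\beta$ has $m$ independent clauses, whose three variables are drawn independently and uniformly and negated independently with probability $\beta$. **Conjecture 2 for $(\beta,\gamma)$.** For every $\epsilon>0$ and every sufficiently large integer constant $\Delta$, there is no polynomial time algorithm that, for all large $n$, refutes more than half (in probability) of the random formulas with imbalance $\beta$, $n$ variables and $m=\Delta n$ clauses, but never refutes a formula with $n\ge 1$ variables and $\Delta n$ clauses that is $(1-\frac32\alpha-\epsilon)$-satisfiable under $\gamma$-biased assignments. **Min UG.** An instance $I$ with $k$ labels consists of a finite loopless multigraph $(V,E)$ and a permutation $\pi_e$ of $[k]$ for each edge $e=(u,v)$. A labeling $f:V\to[k]$ satisfies $e$ if $\pi_e(f(u))=f(v)$, and $Val(I)$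 is the minimum over all labelings of the fraction of unsatisfied edges. Min UG has $(c',s')$-approximation hardness if there is a $k\ge1$ such that, for every $\epsilon'>0$, no polynomial time algorithm distinguishes the instances with $k$ labels and at least one edge that have $Val(I)>s'-\epsilon'$ from those that have $Val(I)<c'+\epsilon'$. **Theorem.** If Conjecture 2 holds for $(\beta,\gamma)$, then, for every $\epsilon\ge0$, Min UG has $(c',s')$-approximation hardness with $$c'=\tfrac12\alpha,\qquad s'=\tfrac14\bigl(1-(1-\beta)^3\bigr)-\epsilon .$$ In particular, if Conjecture 2 holds for all $0<\gamma<\beta<1/2$, then this hardness holds for all $0<\gamma<\beta<1/2$. -/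

import Mathlib

/-! ### Polynomial time -/

/-- `A : α → Bool` is decided by a deterministic (multi-stack) Turing machine whose number of steps
is bounded by a polynomial in the length of the input string `enc x`. -/
def DecidedInPolyTime {α Γ : Type} (enc : α → List Γ) (A : α → Bool) : Prop :=
  Nonempty (Turing.TM2ComputableInPolyTime enc Computability.encodeBool A)

/-! ### Max 3-AND formulas -/

/-- A literal: a variable together with its sign, `true` for the positive literal and `false` for
the negative one. -/
abbrev AndLiteral (n : ℕ) : Type := Fin n × Bool

/-- A clause `l₁ ∧ l₂ ∧ l₃` over `n` variables. -/
abbrev AndClause (n : ℕ) : Type := Fin 3 → AndLiteral n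

/-- A Max 3-AND formula: a number of variables and a finite sequence of clauses. -/
structure AndFormula where
  numVars : ℕ
  clauses : List (AndClause numVars)

/-- A clause is satisfied if all its three literals are true; `true` stands for the value `1`. -/
def AndClause.Satisfied {n : ℕ} (c : AndClause n) (a : Fin n → Bool) : Prop :=
  ∀ j, a (c j).1 = (c j).2

instance {n : ℕ} (c : AndClause n) (a : Fin n → Bool) : Decidable (c.Satisfied a) :=
  inferInstanceAs (Decidable (∀ j, a (c j).1 = (c j).2))

/-- The number of clauses of `φ` satisfied by the assignment `a`. -/
def AndFormula.satCount (φ : AndFormula) (a : Fin φ.numVars → Bool) : ℕ :=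
  φ.clauses.countP fun c => decide (c.Satisfied a)

/-- The assignment `a` is `γ`-biased: at most a fraction `γ` of the variables is assigned `0`. -/
def IsBiased (γ : ℝ) {n : ℕ} (a : Fin n → Bool) : Prop :=
  ((Finset.univ.filter fun i => a i = false).card : ℝ) ≤ γ * n

/-- `φ` is `t`-satisfiable under `γ`-biased assignments: some `γ`-biased assignment satisfies at
least a fraction `t` of the clauses. -/
def AndFormula.BiasedSatisfiable (φ : AndFormula) (γ t : ℝ) : Prop :=
  ∃ a : Fin φ.numVars → Bool, IsBiased γ a ∧ t * φ.clauses.length ≤ φ.satCount a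

/-- Symbols of the input strings that describe formulas. -/
inductive AndSymbol : Type
  | tick
  | sep
  | sign (b : Bool)

/-- A literal as a string: its variable in unary (the variables are listed in the input anyway, so
this is polynomially related to binary indices), then its sign. -/
def AndLiteral.encode {n : ℕ} (l : AndLiteral n) : List AndSymbol :=
  List.replicate (l.1 : ℕ) AndSymbol.tick ++ [AndSymbol.sign l.2]

/-- A formula as a string: one tick per variable, a separator, and the clauses one after another,
each as its three literals. -/
def AndFormula.encode (φ : AndFormula) : List AndSymbol :=
  List.replicate φ.numVars AndSymbol.tick ++ AndSymbol.sep ::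
    φ.clauses.flatMap fun c =>
      AndLiteral.encode (c 0) ++ AndLiteral.encode (c 1) ++ AndLiteral.encode (c 2)

/-! ### Random formulas and their refutation -/

/-- The probability of a clause whose three variables are drawn independently and uniformly from
`n` variables, each being negated independently with probability `β`. -/
noncomputable def clauseProb (β : ℝ) {n : ℕ} (c : AndClause n) : ℝ :=
  ∏ j, (1 / (n : ℝ)) * (if (c j).2 then 1 - β else β)

/-- The probability that a random formula with imbalance `β`, with `n` variables and `m`
independent clauses, is accepted by `A`. -/
noncomputable def randomFormulaProb (β : ℝ) (n m : ℕ) (A : AndFormula → Bool) : ℝ :=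
  ∑ φ : Fin m → AndClause n,
    if A ⟨n, List.ofFn φ⟩ then ∏ i, clauseProb β (φ i) else 0

/-- The answer `true` of `A` is read as "refuted". On formulas with `n ≥ 1` variables and `Δ * n`
clauses, `A` refutes most random formulas with imbalance `β`, for all large `n`, but never refutes a
formula that is `t`-satisfiable under `γ`-biased assignments. -/
def Refutes (β γ t : ℝ) (Δ : ℕ) (A : AndFormula → Bool) : Prop :=
  (∀ᶠ n : ℕ in Filter.atTop, 1 / 2 < randomFormulaProb β n (Δ * n) A) ∧
  ∀ φ : AndFormula, 1 ≤ φ.numVars → φ.clauses.length = Δ * φ.numVars →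
    φ.BiasedSatisfiable γ t → A φ = false

/-- The average-case hardness conjecture for unbalanced Max 3-AND, for one pair `β`, `γ`: for every
`ε > 0` and every sufficiently large constant `Δ`, there is no polynomial time algorithm that
refutes most random formulas with imbalance `β`, with `n` variables and `Δ * n` clauses, but never
refutes a formula that is `(1 - 3 α / 2 - ε)`-satisfiable under `γ`-biased assignments, where
`α = β + γ - 2 β γ`. -/
def UnbalancedAndConjecture (β γ : ℝ) : Prop :=
  ∀ ε : ℝ, 0 < ε → ∃ Δ₀ : ℕ, ∀ Δ : ℕ, Δ₀ ≤ Δ →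
    ¬ ∃ A : AndFormula → Bool, DecidedInPolyTime AndFormula.encode A ∧
      Refutes β γ (1 - 3 / 2 * (β + γ - 2 * β * γ) - ε) Δ A

/-! ### Minimum Unique Game -/

/-- An edge of a Unique Game on `n` vertices with `k` labels; `f` satisfies it if
`perm (f src) = f tgt`. -/
structure UGEdge (n k : ℕ) where
  src : Fin n
  tgt : Fin n
  src_ne_tgt : src ≠ tgt
  perm : Equiv.Perm (Fin k)

/-- A Unique Game with `k` labels: a number of vertices and a finite sequence of edges (parallel
edges are allowed). -/
structure UGInstance (k : ℕ) where
  numVertices : ℕ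
  edges : List (UGEdge numVertices k)

/-- The number of edges that the labeling `f` leaves unsatisfied. -/
def UGInstance.unsatCount {k : ℕ} (I : UGInstance k) (f : Fin I.numVertices → Fin k) : ℕ :=
  I.edges.countP fun e => decide (e.perm (f e.src) ≠ f e.tgt)

/-- The value of a Min UG instance: the minimum over all labelings of the fraction of unsatisfied
edges. -/
noncomputable def UGInstance.minValue {k : ℕ} (I : UGInstance k) : ℝ :=
  ⨅ f : Fin I.numVertices → Fin k, (I.unsatCount f : ℝ) / I.edges.length

/-- Symbols of the input strings that describe Unique Games with `k` labels; as `k` is a constant of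
the problem, this is a finite alphabet that has a symbol for each permutation of the labels. -/
inductive UGSymbol (k : ℕ) : Type
  | tick
  | sep
  | perm (π : Equiv.Perm (Fin k))

/-- An edge as a string: its two ends in unary (the vertices are listed in the input anyway), each
followed by a separator, and its permutation. -/
def UGEdge.encode {n k : ℕ} (e : UGEdge n k) : List (UGSymbol k) :=
  List.replicate (e.src : ℕ) UGSymbol.tick ++ UGSymbol.sep ::
    (List.replicate (e.tgt : ℕ) UGSymbol.tick ++ [UGSymbol.sep, UGSymbol.perm e.perm])

/-- A Unique Game as a string: one tick per vertex, a separator, and the edges one after another. -/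
def UGInstance.encode {k : ℕ} (I : UGInstance k) : List (UGSymbol k) :=
  List.replicate I.numVertices UGSymbol.tick ++ UGSymbol.sep :: I.edges.flatMap UGEdge.encode

/-- `(c, s)`-approximation hardness of Min UG: there is a number `k` of labels such that for no
`ε > 0` a polynomial time algorithm distinguishes the instances (with at least one edge) of value
`> s - ε` from those of value `< c + ε`. -/
def MinUGApproxHard (c s : ℝ) : Prop :=
  ∃ k : ℕ, 1 ≤ k ∧ ∀ ε : ℝ, 0 < ε →
    ¬ ∃ B : UGInstance k → Bool, DecidedInPolyTime UGInstance.encode B ∧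
      (∀ I : UGInstance k, I.edges ≠ [] → s - ε < I.minValue → B I = true) ∧
      (∀ I : UGInstance k, I.edges ≠ [] → I.minValue < c + ε → B I = false)

/-! ### The reduction from Max 3-AND to Unique Games with two labels -/

/-! The proof is a gap reduction to Unique Games with two labels. A label states whether a vertex
agrees with a reference vertex, and each clause becomes a complete graph on the reference vertex and
its three literals. If `k` literals are false, the edges cut number `k(4-k)`: none for a satisfied
clause, 3 or 4 otherwise. A clause may repeat a variable, which would create loops, so each variable
has two copies, tied by a doubled equality edge per occurrence.

With 12 edges per clause, satisfying a fraction `t` gives value at most `(1-t)/3`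
(`AndFormula.minValue_toUG_le`), while if no assignment exceeds `t` the value is at least `(1-t)/4`
(`AndFormula.le_minValue_toUG`). The first bound with `t = 1-3α/2-ε` gives `α/2+ε/3`. For the
second, a fixed assignment satisfies a random clause with probability at most `(1-β)^3`; a Chernoff
bound and a union bound over the `2^n` assignments (`prob_exists_lt_satNum_le`) show that for large
`Δ` most random formulas have no assignment above `(1-β)^3+δ`.

A distinguisher for Unique Games composed with the reduction is thus a refuter. That the composite
runs in polynomial time is proved on an explicit stack machine, which writes the game onto the input
stack of the distinguisher and then simulates it (`DecidedInPolyTime.comp_toUG`). -/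

/-- Source and target of an edge of the clause gadget: the source is the reference vertex or the
first copy of a variable, the target is the second copy of a variable. -/
abbrev EdgeSpec : Type := Option (Fin 3) × Fin 3

/-- The reference vertex, whose label stands for the truth value `1`. -/
def refVertex (n : ℕ) : Fin (2 * n + 1) := ⟨0, by omega⟩

/-- The first copy of a variable. -/
def fstVertex {n : ℕ} (i : Fin n) : Fin (2 * n + 1) := ⟨2 * i + 1, by omega⟩

/-- The second copy of a variable. -/
def sndVertex {n : ℕ} (i : Fin n) : Fin (2 * n + 1) := ⟨2 * i + 2, by omega⟩

/-- The permutation of two labels that expresses equality or inequality. -/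
def signPerm (b : Bool) : Equiv.Perm (Fin 2) := if b then 1 else Equiv.swap 0 1

/-- Whether an edge asks for equal labels, given the signs of the literals of the clause. -/
def EdgeSpec.sign (sgn : Fin 3 → Bool) : EdgeSpec → Bool
  | (none, y) => sgn y
  | (some x, y) => sgn x == sgn y

/-- The edge of the gadget of the clause `c` given by its specification. -/
def AndClause.edge {n : ℕ} (c : AndClause n) (e : EdgeSpec) : UGEdge (2 * n + 1) 2 where
  src := e.1.elim (refVertex n) fun x => fstVertex (c x).1
  tgt := sndVertex (c e.2).1
  src_ne_tgt := by
    rcases e with ⟨_ | x, y⟩ <;> simp [refVertex, fstVertex, sndVertex, Fin.ext_iff]; omega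
  perm := signPerm (e.sign fun j => (c j).2)

/-- The edges of a clause gadget: a complete graph on the reference vertex and the three literals,
and two edges between the copies of each variable. -/
def gadgetSpecs : List EdgeSpec :=
  [(none, 0), (none, 1), (none, 2), (some 0, 1), (some 0, 2), (some 1, 2),
    -- A first copy lies on at most two of the edges between distinct literals, so two equality
    -- edges suffice to make disagreeing copies unprofitable.
    (some 0, 0), (some 0, 0), (some 1, 1), (some 1, 1), (some 2, 2), (some 2, 2)]

/-- The Unique Game of a formula. -/
def AndFormula.toUG (φ : AndFormula) : UGInstance 2 where
  numVertices := 2 * φ.numVars + 1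
  -- A stack machine pushes its output, so what is written first ends up last.
  edges := (φ.clauses.flatMap fun c => gadgetSpecs.map c.edge).reverse

/-! ### Cost of the clause gadget -/

theorem signPerm_apply_ne_iff (b : Bool) (x y : Fin 2) :
    signPerm b x ≠ y ↔ ((x == y) != b) = true := by
  revert b x y; decide

/-- The number of edges of the gadget of `c` that the labeling `f` leaves unsatisfied. -/
def AndClause.cost {n : ℕ} (c : AndClause n) (f : Fin (2 * n + 1) → Fin 2) : ℕ :=
  (gadgetSpecs.map c.edge).countP fun e => decide (e.perm (f e.src) ≠ f e.tgt)

theorem AndClause.cost_eq {n : ℕ} (c : AndClause n) (f : Fin (2 * n + 1) → Fin 2) :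
    c.cost f = gadgetSpecs.countP fun e =>
      (((e.1.elim (f (refVertex n)) fun x => f (fstVertex (c x).1)) == f (sndVertex (c e.2).1)) !=
        e.sign fun j => (c j).2) := by
  unfold AndClause.cost
  rw [List.countP_map]
  congr 1
  funext e
  rcases e with ⟨_ | x, y⟩ <;>
    simp only [Function.comp, AndClause.edge, signPerm_apply_ne_iff, Option.elim, Bool.decide_eq_true]

/-- Replacing `u j` by `v j` saves two equality edges and spoils at most two others, so `u = v` is
the worst case. There the cost is `k(4-k)` with `k` false literals, at least 3 for `1 ≤ k ≤ 3`. The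
finitely many cases are checked by evaluation. -/
theorem three_le_gadget_cost (s : Fin 3 → Bool) (z : Fin 2) (u v : Fin 3 → Fin 2) :
    3 ≤ (gadgetSpecs.countP fun e => (((e.1.elim z u) == v e.2) != e.sign s)) +
      3 * (if ∀ j, decide (v j = z) = s j then 1 else 0) := by
  revert s z u v
  decide

/-- With agreeing copies the cost is exactly `k(4-k)`, which is 0 for `k = 0` and never exceeds 4.
-/
theorem gadget_cost_le_four (s : Fin 3 → Bool) (z : Fin 2) (v : Fin 3 → Fin 2) :
    (gadgetSpecs.countP fun e => (((e.1.elim z v) == v e.2) != e.sign s)) +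
      4 * (if ∀ j, decide (v j = z) = s j then 1 else 0) ≤ 4 := by
  revert s z v
  decide

theorem AndClause.three_le_cost {n : ℕ} (c : AndClause n) (f : Fin (2 * n + 1) → Fin 2) :
    3 ≤ c.cost f +
      3 * (if c.Satisfied fun i => decide (f (sndVertex i) = f (refVertex n)) then 1 else 0) := by
  rw [c.cost_eq]
  exact three_le_gadget_cost (fun j => (c j).2) (f (refVertex n)) (fun j => f (fstVertex (c j).1))
    (fun j => f (sndVertex (c j).1))

theorem AndClause.cost_le_four {n : ℕ} (c : AndClause n) (f : Fin (2 * n + 1) → Fin 2)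
    (hf : ∀ i, f (fstVertex i) = f (sndVertex i)) :
    c.cost f +
      4 * (if c.Satisfied fun i => decide (f (sndVertex i) = f (refVertex n)) then 1 else 0) ≤
        4 := by
  rw [c.cost_eq]
  simp only [hf]
  exact gadget_cost_le_four (fun j => (c j).2) (f (refVertex n)) (fun j => f (sndVertex (c j).1))

/-- The labeling that gives both copies of a variable the label of its truth value. -/
def labelingOf {n : ℕ} (a : Fin n → Bool) (v : Fin (2 * n + 1)) : Fin 2 :=
  if h : (v : ℕ) = 0 then 0 else if a ⟨(v - 1) / 2, by omega⟩ then 0 else 1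

theorem labelingOf_fstVertex {n : ℕ} (a : Fin n → Bool) (i : Fin n) :
    labelingOf a (fstVertex i) = if a i then 0 else 1 := by
  simp [labelingOf, fstVertex]

theorem labelingOf_sndVertex {n : ℕ} (a : Fin n → Bool) (i : Fin n) :
    labelingOf a (sndVertex i) = if a i then 0 else 1 := by
  have h : (2 * (i : ℕ) + 1) / 2 = i := by omega
  simp [labelingOf, sndVertex, h]

theorem decide_labelingOf {n : ℕ} (a : Fin n → Bool) :
    (fun i => decide (labelingOf a (sndVertex i) = labelingOf a (refVertex n))) = a := by
  funext i
  rw [labelingOf_sndVertex]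
  cases h : a i <;> simp [labelingOf, refVertex]

theorem AndFormula.unsatCount_toUG (φ : AndFormula)
    (f : Fin (2 * φ.numVars + 1) → Fin 2) :
    φ.toUG.unsatCount f = (φ.clauses.map fun c => c.cost f).sum := by
  simp only [UGInstance.unsatCount, AndFormula.toUG, List.countP_reverse, List.countP_flatMap]
  rfl

theorem AndFormula.length_toUG_edges (φ : AndFormula) :
    φ.toUG.edges.length = 12 * φ.clauses.length := by
  simp [AndFormula.toUG, gadgetSpecs, List.length_flatMap, mul_comm]

theorem AndFormula.three_mul_length_le (φ : AndFormula) (f : Fin (2 * φ.numVars + 1) → Fin 2) :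
    3 * φ.clauses.length ≤ φ.toUG.unsatCount f +
      3 * φ.satCount fun i => decide (f (sndVertex i) = f (refVertex _)) := by
  rw [φ.unsatCount_toUG, AndFormula.satCount]
  generalize φ.clauses = l
  induction l with
  | nil => simp
  | cons c l ih =>
    have := c.three_le_cost f
    simp only [List.length_cons, List.map_cons, List.sum_cons, List.countP_cons, decide_eq_true_eq]
    omega

theorem AndFormula.unsatCount_labelingOf_le (φ : AndFormula) (a : Fin φ.numVars → Bool) :
    φ.toUG.unsatCount (labelingOf a) + 4 * φ.satCount a ≤ 4 * φ.clauses.length := by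
  rw [φ.unsatCount_toUG, AndFormula.satCount]
  generalize φ.clauses = l
  induction l with
  | nil => simp
  | cons c l ih =>
    have := c.cost_le_four (labelingOf a) fun i => by
      rw [labelingOf_fstVertex, labelingOf_sndVertex]
    rw [decide_labelingOf] at this
    simp only [List.length_cons, List.map_cons, List.sum_cons, List.countP_cons, decide_eq_true_eq]
    omega

/-! ### Value of the Unique Game of a formula -/

theorem UGInstance.minValue_le {k : ℕ} (I : UGInstance k) (f : Fin I.numVertices → Fin k) :
    I.minValue ≤ (I.unsatCount f : ℝ) / I.edges.length :=
  ciInf_le ⟨0, by rintro _ ⟨g, rfl⟩; positivity⟩ f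

/-- A formula that is `t`-satisfiable is mapped to a Unique Game of value at most `(1 - t) / 3`. -/
theorem AndFormula.minValue_toUG_le (φ : AndFormula) (hφ : φ.clauses ≠ []) {γ t : ℝ}
    (h : φ.BiasedSatisfiable γ t) : φ.toUG.minValue ≤ (1 - t) / 3 := by
  obtain ⟨a, -, ha⟩ := h
  refine (φ.toUG.minValue_le (labelingOf a)).trans ?_
  have hlen : (0 : ℝ) < φ.clauses.length := by
    exact_mod_cast List.length_pos_iff.2 hφ
  have hle : (φ.toUG.unsatCount (labelingOf a) : ℝ) + 4 * φ.satCount a ≤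
      4 * φ.clauses.length := by
    exact_mod_cast φ.unsatCount_labelingOf_le a
  rw [φ.length_toUG_edges, div_le_iff₀ (by push_cast; positivity)]
  push_cast
  linarith

/-- If no assignment satisfies a fraction `t` of the clauses, then the Unique Game of the formula
has value at least `(1 - t) / 4`. -/
theorem AndFormula.le_minValue_toUG (φ : AndFormula) (hφ : φ.clauses ≠ []) {t : ℝ}
    (h : ∀ a, (φ.satCount a : ℝ) ≤ t * φ.clauses.length) : (1 - t) / 4 ≤ φ.toUG.minValue := by
  have : Nonempty (Fin φ.toUG.numVertices → Fin 2) := ⟨fun _ => 0⟩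
  refine le_ciInf fun f => ?_
  have hlen : (0 : ℝ) < φ.clauses.length := by
    exact_mod_cast List.length_pos_iff.2 hφ
  have hle : 3 * (φ.clauses.length : ℝ) ≤ φ.toUG.unsatCount f +
      3 * φ.satCount fun i => decide (f (sndVertex i) = f (refVertex _)) := by
    exact_mod_cast φ.three_mul_length_le f
  have := h fun i => decide (f (sndVertex i) = f (refVertex _))
  rw [φ.length_toUG_edges, le_div_iff₀ (by push_cast; positivity)]
  push_cast
  linarith

/-! ### No assignment satisfies many clauses of a random formula -/

/-- The probability of a literal of a random formula. -/
noncomputable def literalProb (β : ℝ) {n : ℕ} (l : AndLiteral n) : ℝ :=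
  1 / (n : ℝ) * (if l.2 then 1 - β else β)

theorem literalProb_nonneg {β : ℝ} (h0 : 0 ≤ β) (h1 : β ≤ 1) {n : ℕ} (l : AndLiteral n) :
    0 ≤ literalProb β l := by
  unfold literalProb
  split_ifs
  · exact mul_nonneg (by positivity) (by linarith)
  · positivity

theorem clauseProb_nonneg {β : ℝ} (h0 : 0 ≤ β) (h1 : β ≤ 1) {n : ℕ} (c : AndClause n) :
    0 ≤ clauseProb β c :=
  Finset.prod_nonneg fun j _ => literalProb_nonneg h0 h1 (c j)

theorem sum_literalProb {β : ℝ} {n : ℕ} (hn : n ≠ 0) :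
    ∑ l : AndLiteral n, literalProb β l = 1 := by
  have : (n : ℝ) ≠ 0 := by exact_mod_cast hn
  simp only [literalProb, Fintype.sum_prod_type, Fintype.sum_bool]
  simp
  field_simp
  ring

/-- Each variable has one true literal, of probability `(1 - β) / n` or `β / n`, and `β ≤ 1 - β`. -/
theorem sum_literalProb_true_le {β : ℝ} (h1 : β ≤ 1 / 2) {n : ℕ} (hn : n ≠ 0)
    (a : Fin n → Bool) :
    ∑ l : AndLiteral n, (if a l.1 = l.2 then literalProb β l else 0) ≤ 1 - β := by
  have hn' : (0 : ℝ) < n := by exact_mod_cast Nat.pos_of_ne_zero hn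
  simp only [literalProb, Fintype.sum_prod_type, Fintype.sum_bool]
  calc _ ≤ ∑ _i : Fin n, 1 / (n : ℝ) * (1 - β) := by
        refine Finset.sum_le_sum fun i _ => ?_
        cases a i
        · simp only [Bool.false_eq_true, if_false, if_true, zero_add]
          gcongr
          linarith
        · simp
    _ = 1 - β := by
        simp
        field_simp

theorem sum_clauseProb {β : ℝ} {n : ℕ} (hn : n ≠ 0) :
    ∑ c : AndClause n, clauseProb β c = 1 := by
  have := Finset.sum_pow' (Finset.univ : Finset (AndLiteral n)) (literalProb β) 3
  rw [Fintype.piFinset_univ, sum_literalProb hn, one_pow] at this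
  exact this.symm

/-- The three literals are independent, so the probability factors into the cube of the one for a
single literal. -/
theorem sum_clauseProb_satisfied_le {β : ℝ} (h0 : 0 ≤ β) (h1 : β ≤ 1 / 2) {n : ℕ} (hn : n ≠ 0)
    (a : Fin n → Bool) :
    ∑ c : AndClause n, (if c.Satisfied a then clauseProb β c else 0) ≤ (1 - β) ^ 3 := by
  have h := Finset.sum_pow' (Finset.univ : Finset (AndLiteral n))
    (fun l => if a l.1 = l.2 then literalProb β l else 0) 3
  rw [Fintype.piFinset_univ] at h
  have hle : (∑ l : AndLiteral n, (if a l.1 = l.2 then literalProb β l else 0)) ^ 3 ≤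
      (1 - β) ^ 3 := by
    refine pow_le_pow_left₀ (Finset.sum_nonneg fun l _ => ?_) (sum_literalProb_true_le h1 hn a) 3
    split_ifs
    · exact literalProb_nonneg h0 (by linarith) l
    · exact le_rfl
  refine le_trans (le_of_eq ?_) hle
  rw [h]
  refine Finset.sum_congr rfl fun c _ => ?_
  rw [Finset.prod_ite_zero]
  simp only [Finset.mem_univ, true_imp_iff]
  rfl

/-- The number of clauses of `φ` that `a` satisfies. -/
def satNum {n m : ℕ} (φ : Fin m → AndClause n) (a : Fin n → Bool) : ℕ :=
  (Finset.univ.filter fun i => (φ i).Satisfied a).card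

theorem List.countP_ofFn_eq_sum {α : Type*} (p : α → Bool) {m : ℕ} (g : Fin m → α) :
    (List.ofFn g).countP p = ∑ i, if p (g i) then 1 else 0 := by
  induction m with
  | zero => simp
  | succ m ih => rw [List.ofFn_succ, List.countP_cons, ih, Fin.sum_univ_succ, add_comm]

theorem satCount_ofFn {n m : ℕ} (φ : Fin m → AndClause n) (a : Fin n → Bool) :
    AndFormula.satCount ⟨n, List.ofFn φ⟩ a = satNum φ a := by
  rw [AndFormula.satCount, satNum, Finset.card_filter, List.countP_ofFn_eq_sum]
  simp only [decide_eq_true_eq]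

/-- Moment generating function of the number of satisfied clauses, with `1 + r` in the role of the
exponential of the Chernoff parameter. By independence it is a power of the contribution of one
clause. -/
theorem sum_exp_satNum_le {β : ℝ} (h0 : 0 ≤ β) (h1 : β ≤ 1 / 2) {n : ℕ} (hn : n ≠ 0) (m : ℕ)
    (a : Fin n → Bool) {r : ℝ} (hr : 0 ≤ r) :
    ∑ φ : Fin m → AndClause n, (∏ i, clauseProb β (φ i)) * (1 + r) ^ satNum φ a ≤
      (1 + r * (1 - β) ^ 3) ^ m := by
  have h := Finset.sum_pow' (Finset.univ : Finset (AndClause n))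
    (fun c => clauseProb β c * if c.Satisfied a then 1 + r else 1) m
  rw [Fintype.piFinset_univ] at h
  have hsum : ∑ c : AndClause n, clauseProb β c * (if c.Satisfied a then 1 + r else 1) =
      1 + r * ∑ c : AndClause n, (if c.Satisfied a then clauseProb β c else 0) := by
    rw [Finset.mul_sum]
    conv_rhs => rw [← sum_clauseProb (β := β) hn]
    rw [← Finset.sum_add_distrib]
    refine Finset.sum_congr rfl fun c _ => ?_
    split_ifs <;> ring
  have hpos : 0 ≤ ∑ c : AndClause n, (if c.Satisfied a then clauseProb β c else 0) :=
    Finset.sum_nonneg fun c _ => by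
      split_ifs
      · exact clauseProb_nonneg h0 (by linarith) c
      · exact le_rfl
  calc _ = ∑ φ : Fin m → AndClause n,
        ∏ i, (clauseProb β (φ i) * if (φ i).Satisfied a then 1 + r else 1) := by
        refine Finset.sum_congr rfl fun φ _ => ?_
        rw [Finset.prod_mul_distrib, Finset.prod_ite, Finset.prod_const, Finset.prod_const_one,
          mul_one]
        rfl
    _ = (1 + r * ∑ c : AndClause n, (if c.Satisfied a then clauseProb β c else 0)) ^ m := by
        rw [← h, hsum]
    _ ≤ _ := by
        gcongr
        exact sum_clauseProb_satisfied_le h0 h1 hn a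

/-- The probability that some assignment satisfies many clauses of a random formula. -/
theorem prob_exists_lt_satNum_le {β : ℝ} (h0 : 0 ≤ β) (h1 : β ≤ 1 / 2) {n : ℕ} (hn : n ≠ 0)
    (m : ℕ) {δ : ℝ} (hδ : 0 ≤ δ) (hδ1 : δ ≤ 1) :
    ∑ φ : Fin m → AndClause n, (∏ i, clauseProb β (φ i)) *
      (if ∃ a, ((1 - β) ^ 3 + δ) * m < satNum φ a then 1 else 0) ≤
      2 ^ n * Real.exp (-(m * (δ ^ 2 / 4))) := by
  set q := (1 - β) ^ 3 with hq
  have hq0 : 0 ≤ q := pow_nonneg (by linarith) 3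
  have hq1 : q ≤ 1 := pow_le_one₀ (by linarith) (by linarith)
  -- The Chernoff parameter is `δ / 2`; it is at most 1 in absolute value, as the quadratic bound
  -- requires.
  have hexp : Real.exp (δ / 2) ≤ 1 + δ / 2 + (δ / 2) ^ 2 := by
    have := (abs_le.1 (Real.abs_exp_sub_one_sub_id_le (x := δ / 2)
      (abs_le.2 ⟨by linarith, by linarith⟩))).2
    linarith
  have hr : 0 ≤ Real.exp (δ / 2) - 1 := by
    have := Real.add_one_le_exp (δ / 2)
    linarith
  have hone (a : Fin n → Bool) : ∑ φ : Fin m → AndClause n, (∏ i, clauseProb β (φ i)) *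
      Real.exp (δ / 2 * (satNum φ a - (q + δ) * m)) ≤ Real.exp (-(m * (δ ^ 2 / 4))) := by
    have h := sum_exp_satNum_le h0 h1 hn m a hr
    rw [add_sub_cancel] at h
    calc _ = (∑ φ : Fin m → AndClause n, (∏ i, clauseProb β (φ i)) *
          Real.exp (δ / 2) ^ satNum φ a) * Real.exp (-(δ / 2 * ((q + δ) * m))) := by
          rw [Finset.sum_mul]
          refine Finset.sum_congr rfl fun φ _ => ?_
          rw [mul_assoc, ← Real.exp_nat_mul, ← Real.exp_add]
          ring_nf
      _ ≤ Real.exp ((Real.exp (δ / 2) - 1) * q) ^ m * Real.exp (-(δ / 2 * ((q + δ) * m))) := by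
          gcongr
          refine h.trans ?_
          gcongr
          have := Real.add_one_le_exp ((Real.exp (δ / 2) - 1) * q)
          linarith
      _ = Real.exp (m * ((Real.exp (δ / 2) - 1) * q - δ / 2 * (q + δ))) := by
          rw [← Real.exp_nat_mul, ← Real.exp_add]
          ring_nf
      _ ≤ _ := by
          rw [← mul_neg]
          gcongr
          -- Per clause the exponent is at most `q δ² / 4 - δ² / 2`, hence at most `-δ² / 4` because
          -- `q ≤ 1`.
          nlinarith [mul_nonneg (sq_nonneg (δ / 2)) (sub_nonneg.2 hq1),
            mul_le_mul_of_nonneg_right hexp hq0]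
  -- Markov and union bound at once: an assignment above the threshold has a nonnegative exponent,
  -- so its term alone is at least 1.
  calc _ ≤ ∑ φ : Fin m → AndClause n, (∏ i, clauseProb β (φ i)) *
        ∑ a : Fin n → Bool, Real.exp (δ / 2 * (satNum φ a - (q + δ) * m)) := by
        refine Finset.sum_le_sum fun φ _ => mul_le_mul_of_nonneg_left ?_
          (Finset.prod_nonneg fun i _ => clauseProb_nonneg h0 (by linarith) _)
        split_ifs with h
        · obtain ⟨a, ha⟩ := h
          refine le_trans ?_ (Finset.single_le_sum (f := fun a : Fin n → Bool =>
            Real.exp (δ / 2 * (satNum φ a - (q + δ) * m))) (fun _ _ => (Real.exp_pos _).le)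
            (Finset.mem_univ a))
          exact Real.one_le_exp (mul_nonneg (by linarith) (by linarith))
        · exact Finset.sum_nonneg fun _ _ => (Real.exp_pos _).le
    _ = ∑ a : Fin n → Bool, ∑ φ : Fin m → AndClause n, (∏ i, clauseProb β (φ i)) *
        Real.exp (δ / 2 * (satNum φ a - (q + δ) * m)) := by
        simp only [Finset.mul_sum]
        exact Finset.sum_comm
    _ ≤ ∑ _a : Fin n → Bool, Real.exp (-(m * (δ ^ 2 / 4))) := Finset.sum_le_sum fun a _ => hone a
    _ = _ := by simp

theorem sum_prod_clauseProb {β : ℝ} {n : ℕ} (hn : n ≠ 0) (m : ℕ) :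
    ∑ φ : Fin m → AndClause n, ∏ i, clauseProb β (φ i) = 1 := by
  have h := Finset.sum_pow' (Finset.univ : Finset (AndClause n)) (clauseProb β) m
  rw [Fintype.piFinset_univ, sum_clauseProb hn, one_pow] at h
  exact h.symm

/-- An algorithm that accepts all formulas without a good assignment accepts most random
formulas. -/
theorem eventually_half_lt_randomFormulaProb {β : ℝ} (h0 : 0 ≤ β) (h1 : β ≤ 1 / 2) {δ : ℝ}
    (hδ : 0 ≤ δ) (hδ1 : δ ≤ 1) {Δ : ℕ} (hΔ : 4 ≤ Δ * δ ^ 2) {A : AndFormula → Bool}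
    (hA : ∀ φ : AndFormula, 1 ≤ φ.numVars → φ.clauses.length = Δ * φ.numVars →
      (∀ a, (φ.satCount a : ℝ) ≤ ((1 - β) ^ 3 + δ) * φ.clauses.length) → A φ = true) :
    ∀ᶠ n : ℕ in Filter.atTop, 1 / 2 < randomFormulaProb β n (Δ * n) A := by
  -- Since `Δ δ² ≥ 4`, the tail is at most `exp (-n)`, which beats the `2 ^ n` assignments because
  -- `2 < e`.
  have htend : Filter.Tendsto (fun n : ℕ => (2 * Real.exp (-1)) ^ n) Filter.atTop (nhds 0) := by
    refine tendsto_pow_atTop_nhds_zero_of_lt_one (by positivity) ?_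
    rw [Real.exp_neg, ← div_eq_mul_inv, div_lt_one (Real.exp_pos 1)]
    linarith [Real.exp_one_gt_d9]
  filter_upwards [htend.eventually (gt_mem_nhds (show (0 : ℝ) < 1 / 2 by norm_num)),
    Filter.eventually_ge_atTop 1] with n hsmall hn
  have hn0 : n ≠ 0 := by omega
  have hbad := prob_exists_lt_satNum_le h0 h1 hn0 (Δ * n) hδ hδ1
  have hle : (2 : ℝ) ^ n * Real.exp (-((Δ * n : ℕ) * (δ ^ 2 / 4))) ≤ (2 * Real.exp (-1)) ^ n := by
    rw [mul_pow, ← Real.exp_nat_mul]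
    gcongr
    push_cast
    nlinarith [(Nat.cast_nonneg n : (0 : ℝ) ≤ n)]
  -- Every formula is accepted or has an assignment above the threshold, so the two events cover the
  -- whole probability.
  have hsum : 1 ≤ randomFormulaProb β n (Δ * n) A +
      ∑ φ : Fin (Δ * n) → AndClause n, (∏ i, clauseProb β (φ i)) *
        (if ∃ a, ((1 - β) ^ 3 + δ) * (Δ * n : ℕ) < satNum φ a then 1 else 0) := by
    rw [randomFormulaProb, ← Finset.sum_add_distrib]
    refine (sum_prod_clauseProb (β := β) hn0 (Δ * n)).symm.trans_le ?_
    refine Finset.sum_le_sum fun φ _ => ?_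
    have hnn : 0 ≤ ∏ i, clauseProb β (φ i) :=
      Finset.prod_nonneg fun i _ => clauseProb_nonneg h0 (by linarith) _
    by_cases h : ∃ a, ((1 - β) ^ 3 + δ) * (Δ * n : ℕ) < satNum φ a
    · rw [if_pos h, mul_one]
      split_ifs <;> linarith
    · have hAφ : A ⟨n, List.ofFn φ⟩ = true := by
        refine hA _ hn (by simp) fun a => ?_
        rw [satCount_ofFn, List.length_ofFn]
        exact not_lt.1 fun hlt => h ⟨a, hlt⟩
      rw [if_neg h, if_pos hAφ, mul_zero, add_zero]
  linarith

/-! ### Bounded runs of transition systems -/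

/-- `f` leads from `a` to `b` in at most `m` steps. -/
def RunsIn {τ : Type*} (f : τ → Option τ) (m : ℕ) (a b : τ) : Prop :=
  Nonempty (StateTransition.EvalsToInTime f a (some b) m)

namespace RunsIn

variable {τ : Type*} {f : τ → Option τ} {m m' : ℕ} {a b c : τ}

theorem refl (f : τ → Option τ) (a : τ) : RunsIn f 0 a a := ⟨.refl f a⟩

theorem single (h : f a = some b) : RunsIn f 1 a b := ⟨⟨⟨1, by simpa [flip] using h⟩, le_rfl⟩⟩

theorem mono (h : RunsIn f m a b) (hm : m ≤ m') : RunsIn f m' a b :=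
  h.map fun e => ⟨e.toEvalsTo, e.steps_le_m.trans hm⟩

theorem trans (h : RunsIn f m a b) (h' : RunsIn f m' b c) : RunsIn f (m + m') a c := by
  obtain ⟨e⟩ := h
  obtain ⟨e'⟩ := h'
  exact add_comm m m' ▸ ⟨.trans f m m' a b _ e e'⟩

theorem head (h : f a = some b) (h' : RunsIn f m b c) : RunsIn f (m + 1) a c :=
  ((single h).trans h').mono (by omega)

/-- A map that commutes with the transitions maps runs to runs. -/
theorem map {τ' : Type*} {f' : τ' → Option τ'} (g : τ → τ')
    (hg : ∀ x y, f x = some y → f' (g x) = some (g y)) (h : RunsIn f m a b) :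
    RunsIn f' m (g a) (g b) := by
  obtain ⟨⟨n, hn⟩, hle⟩ := h
  refine ⟨⟨⟨n, ?_⟩, hle⟩⟩
  clear hle
  induction n generalizing b with
  | zero => simp_all
  | succ n ih =>
    rw [Function.iterate_succ_apply'] at hn ⊢
    -- `none` is absorbing, so a run that ends in `some b` had a configuration before its last step.
    cases h : (flip bind f)^[n] (some a) with
    | none => rw [h] at hn; simp [flip] at hn
    | some x =>
      rw [h] at hn
      rw [ih h]
      exact hg x b (by simpa [flip] using hn)

end RunsIn

open Turing

/-! ### A stack machine that writes the Unique Game of a formula -/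

/-- The additional stacks of the reduction: the input, the number of variables in unary, a scratch
stack, and the three variables of the current clause in unary. -/
inductive WorkStack : Type
  | input
  | count
  | scratch
  | var (j : Fin 3)
  deriving DecidableEq, Fintype

/-- An instruction of the clause gadget writer: write a symbol that depends on the signs of the
current clause, or write two ticks for each tick of the `j`-th variable. -/
inductive Token : Type
  | sym (f : (Fin 3 → Bool) → UGSymbol 2)
  | copy (j : Fin 3)

/-- What an instruction writes, given the signs and the variables of the current clause. -/
def Token.eval (s : Fin 3 → Bool) (a : Fin 3 → ℕ) : Token → List (UGSymbol 2)
  | sym f => [f s]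
  | copy j => List.replicate (2 * a j) UGSymbol.tick

/-- The labels of the reduction, for a gadget writer with `N` instructions. -/
inductive ReductionLabel (N : ℕ) : Type
  | readCount
  | readVar (j : Fin 3)
  | exec (i : Fin (N + 1))
  | restore (j : Fin 3) (i : Fin (N + 1))
  | clear (j : Fin 3)
  | writeCount
  deriving Fintype

noncomputable instance : Fintype AndSymbol :=
  haveI := Classical.decEq AndSymbol
  Fintype.ofSurjective
    (fun x : Option (Option Bool) => match x with
      | none => AndSymbol.tick
      | some none => AndSymbol.sep
      | some (some b) => AndSymbol.sign b)
    (by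
      rintro (_ | _ | b)
      exacts [⟨none, rfl⟩, ⟨some none, rfl⟩, ⟨some (some b), rfl⟩])

/-- A list of ticks. -/
def ticks (n : ℕ) : List AndSymbol := List.replicate n .tick

theorem tick_cons_ticks (n : ℕ) : AndSymbol.tick :: ticks n = ticks (n + 1) := rfl

theorem head?_ticks_zero : (ticks 0).head? = none := rfl

theorem head?_ticks_succ (n : ℕ) : (ticks (n + 1)).head? = some .tick := rfl

theorem tail_ticks_zero : (ticks 0).tail = ticks 0 := rfl

theorem tail_ticks_succ (n : ℕ) : (ticks (n + 1)).tail = ticks n := rfl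

/-- Whether the symbol that was popped last is a tick. -/
def isTick : Option AndSymbol → Bool
  | some .tick => true
  | _ => false

/-- The sign that was popped last, if any. -/
def lastSign : Option AndSymbol → Option Bool
  | some (.sign b) => some b
  | _ => none

namespace Reduction

variable (tm : FinTM2) (code : UGSymbol 2 → tm.Γ tm.k₀) (prog : List Token)

/-- The alphabets of the stacks. -/
abbrev Alphabet : WorkStack ⊕ tm.K → Type
  | .inl _ => AndSymbol
  | .inr k => tm.Γ k

/-- The internal states: the signs of the current clause and the symbol popped last, and the states
of the machine that is run afterwards. -/
abbrev State : Type := ((Fin 3 → Bool) × Option AndSymbol) × tm.σ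

/-- The labels, those of the reduction and those of the machine that is run afterwards. -/
abbrev Label : Type := ReductionLabel prog.length ⊕ tm.Λ

/-- The statements of the combined machine. -/
abbrev Stmt : Type := TM2.Stmt (Alphabet tm) (Label tm prog) (State tm)

/-- The configurations of the combined machine. -/
abbrev Cfg : Type := TM2.Cfg (Alphabet tm) (Label tm prog) (State tm)

/-- The next instruction. -/
def next {N : ℕ} (i : Fin (N + 1)) : Fin (N + 1) := ⟨min (i + 1) N, by omega⟩

variable {tm prog}

/-- Jump to a label of the reduction. -/
def jump (l : ReductionLabel prog.length) : Stmt tm prog := .goto fun _ => .inl l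

/-- Pop a symbol from a working stack and store it. -/
def popWork (k : WorkStack) (q : Stmt tm prog) : Stmt tm prog :=
  .pop (.inl k) (fun v o => ((v.1.1, o), v.2)) q

/-- Forget the symbol popped last. -/
def forget (q : Stmt tm prog) : Stmt tm prog := .load (fun v => ((v.1.1, none), v.2)) q

/-- Forget the symbol popped last; `q` if it was a tick and `q'` if not. -/
def ifTick (q q' : Stmt tm prog) : Stmt tm prog :=
  .branch (fun v => isTick v.1.2) (forget q) (forget q')

/-- Push a tick on a working stack. -/
def pushTick (k : WorkStack) (q : Stmt tm prog) : Stmt tm prog :=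
  .push (.inl k) (fun _ => AndSymbol.tick) q

/-- Write a symbol. -/
def write (f : (Fin 3 → Bool) → UGSymbol 2) (q : Stmt tm prog) : Stmt tm prog :=
  .push (.inr tm.k₀) (fun v => code (f v.1.1)) q

/-- A statement of the machine that is run afterwards, as a statement of the combined machine. -/
def liftStmt : TM2.Stmt tm.Γ tm.Λ tm.σ → Stmt tm prog
  | .push k f q => .push (.inr k) (fun v => f v.2) (liftStmt q)
  | .peek k f q => .peek (.inr k) (fun v o => (v.1, f v.2 o)) (liftStmt q)
  | .pop k f q => .pop (.inr k) (fun v o => (v.1, f v.2 o)) (liftStmt q)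
  | .load f q => .load (fun v => (v.1, f v.2)) (liftStmt q)
  | .branch f q q' => .branch (fun v => f v.2) (liftStmt q) (liftStmt q')
  | .goto f => .goto fun v => .inr (f v.2)
  | .halt => .halt

/-- Where to go after the `j`-th variable of a clause has been read. -/
def afterRead : Fin 3 → ReductionLabel prog.length :=
  ![.readVar 1, .readVar 2, .exec 0]

/-- Where to go after the stack of the `j`-th variable has been cleared. -/
def afterClear : Fin 3 → ReductionLabel prog.length :=
  ![.clear 1, .clear 2, .readVar 0]

/-- The program of the reduction. -/
def program : ReductionLabel prog.length → Stmt tm prog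
  | .readCount => popWork .input <|
      ifTick (pushTick .count <| jump .readCount) (jump (.readVar 0))
  | .readVar j => popWork .input <|
      .branch (fun v => isTick v.1.2) (forget <| pushTick (.var j) <| jump (.readVar j)) <|
      .branch (fun v => (lastSign v.1.2).isSome)
        (.load (fun v => ((Function.update v.1.1 j ((lastSign v.1.2).getD false), none), v.2)) <|
          jump (afterRead j)) <|
        -- End of the input: the separator precedes all edges in the output, and the extra tick
        -- counts the reference vertex in `2 * n + 1`.
        forget <| write code (fun _ => .sep) <| write code (fun _ => .tick) <| jump .writeCount
  | .exec i => match prog[(i : ℕ)]? with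
    | none => jump (.clear 0)
    | some (.sym f) => write code f <| jump (.exec (next i))
    | some (.copy j) => popWork (.var j) <|
        ifTick (pushTick .scratch <| write code (fun _ => .tick) <| write code (fun _ => .tick) <|
          jump (.exec i)) (jump (.restore j (next i)))
  | .restore j i => popWork .scratch <|
      ifTick (pushTick (.var j) <| jump (.restore j i)) (jump (.exec i))
  | .clear j => popWork (.var j) <| ifTick (jump (.clear j)) (jump (afterClear j))
  | .writeCount => popWork .count <|
      ifTick (write code (fun _ => .tick) <| write code (fun _ => .tick) <| jump .writeCount)
        -- The signs are reset because a halting configuration must carry the initial state.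
        (.load (fun v => ((fun _ => false, none), v.2)) <| .goto fun _ => .inr tm.main)

variable (tm prog) in
/-- The machine that first writes the Unique Game of a formula and then runs `tm` on it. -/
noncomputable def machine : FinTM2 where
  K := WorkStack ⊕ tm.K
  kDecidableEq := haveI := tm.kDecidableEq; inferInstance
  kFin := haveI := tm.kFin; inferInstance
  k₀ := .inl .input
  k₁ := .inr tm.k₁
  Γ := Alphabet tm
  Λ := Label tm prog
  main := .inl .readCount
  ΛFin := haveI := tm.ΛFin; inferInstance
  σ := State tm
  initialState := ((fun _ => false, none), tm.initialState)
  σFin := haveI := tm.σFin; inferInstance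
  Γk₀Fin := inferInstanceAs (Fintype AndSymbol)
  m := Sum.elim (program code) fun l => liftStmt (tm.m l)

/-- The stacks while the reduction is running. -/
def workStacks (inp : List AndSymbol) (n t : ℕ) (a : Fin 3 → ℕ) (out : List (tm.Γ tm.k₀)) :
    ∀ k, List (Alphabet tm k)
  | .inl .input => inp
  | .inl .count => ticks n
  | .inl .scratch => ticks t
  | .inl (.var j) => ticks (a j)
  | .inr k => Function.update (fun _ => []) tm.k₀ out k

section Stacks

variable (inp : List AndSymbol) (n t : ℕ) (a : Fin 3 → ℕ) (out : List (tm.Γ tm.k₀))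

theorem workStacks_input : workStacks inp n t a out (.inl .input) = inp := rfl

theorem workStacks_count : workStacks inp n t a out (.inl .count) = ticks n := rfl

theorem workStacks_scratch : workStacks inp n t a out (.inl .scratch) = ticks t := rfl

theorem workStacks_var (j : Fin 3) :
    workStacks inp n t a out (.inl (.var j)) = ticks (a j) := rfl

theorem workStacks_out : workStacks inp n t a out (.inr tm.k₀) = out := by simp [workStacks]

theorem update_input (l : List AndSymbol) :
    Function.update (workStacks inp n t a out) (.inl .input) l = workStacks l n t a out := by
  funext k
  rcases k with (_ | _ | _ | j) | k <;> simp [Function.update, workStacks]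

theorem update_count (m : ℕ) :
    Function.update (workStacks inp n t a out) (.inl .count) (ticks m) =
      workStacks inp m t a out := by
  funext k
  rcases k with (_ | _ | _ | j) | k <;> simp [Function.update, workStacks]

theorem update_scratch (m : ℕ) :
    Function.update (workStacks inp n t a out) (.inl .scratch) (ticks m) =
      workStacks inp n m a out := by
  funext k
  rcases k with (_ | _ | _ | j) | k <;> simp [Function.update, workStacks]

theorem update_var (j : Fin 3) (m : ℕ) :
    Function.update (workStacks inp n t a out) (.inl (.var j)) (ticks m) =
      workStacks inp n t (Function.update a j m) out := by
  funext k
  rcases k with (_ | _ | _ | i) | k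
  · simp [Function.update, workStacks]
  · simp [Function.update, workStacks]
  · simp [Function.update, workStacks]
  · by_cases h : i = j
    · subst h; simp [workStacks]
    · simp [Function.update, workStacks, h]
  · simp [Function.update, workStacks]

theorem update_out (l : List (tm.Γ tm.k₀)) :
    Function.update (workStacks inp n t a out) (.inr tm.k₀) l = workStacks inp n t a l := by
  funext k
  rcases k with (_ | _ | _ | j) | k
  · simp [Function.update, workStacks]
  · simp [Function.update, workStacks]
  · simp [Function.update, workStacks]
  · simp [Function.update, workStacks]
  · by_cases h : k = tm.k₀
    · subst h; simp [workStacks]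
    · simp [workStacks, h]

end Stacks

/-- A configuration while the reduction is running. -/
def cfg (l : ReductionLabel prog.length) (s : Fin 3 → Bool) (inp : List AndSymbol) (n t : ℕ)
    (a : Fin 3 → ℕ) (out : List (tm.Γ tm.k₀)) : Cfg tm prog :=
  ⟨some (.inl l), ((s, none), tm.initialState), workStacks inp n t a out⟩

/-- The transition function of the combined machine. -/
abbrev step : Cfg tm prog → Option (Cfg tm prog) :=
  TM2.step (Sum.elim (program code) fun l => liftStmt (tm.m l))

/-! #### Running the second machine -/

/-- The configuration of the combined machine while `tm` is running. -/
def liftCfg (c : TM2.Cfg tm.Γ tm.Λ tm.σ) : Cfg tm prog where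
  l := c.l.map .inr
  var := ((fun _ => false, none), c.var)
  stk
    | .inl _ => []
    | .inr k => c.stk k

/-- A lifted statement touches only the stacks and the state component of `tm`, so lifting commutes
with execution. -/
theorem stepAux_liftStmt (q : TM2.Stmt tm.Γ tm.Λ tm.σ) (v : tm.σ) (S : ∀ k, List (tm.Γ k)) :
    TM2.stepAux (liftStmt (prog := prog) q) ((fun _ => false, none), v)
      (liftCfg (prog := prog) ⟨none, v, S⟩).stk = liftCfg (TM2.stepAux q v S) := by
  have hupd (k : tm.K) (v : tm.σ) (S : ∀ k, List (tm.Γ k)) (l : List (tm.Γ k)) :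
      Function.update (liftCfg (prog := prog) ⟨none, v, S⟩).stk (.inr k) l =
        (liftCfg (prog := prog) ⟨none, v, Function.update S k l⟩).stk := by
    funext i
    rcases i with i | i
    · simp [liftCfg]
    · by_cases h : i = k
      · subst h; simp [liftCfg]
      · simp [liftCfg, h]
  induction q generalizing v S with
  | push k f q ih =>
    simp only [liftStmt, TM2.stepAux]
    exact (congrArg (TM2.stepAux (liftStmt q) _) (hupd k v S (f v :: S k))).trans (ih _ _)
  | peek k f q ih =>
    simp only [liftStmt, TM2.stepAux]
    exact ih _ _
  | pop k f q ih =>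
    simp only [liftStmt, TM2.stepAux]
    exact (congrArg (TM2.stepAux (liftStmt q) _) (hupd k v S (S k).tail)).trans (ih _ _)
  | load f q ih =>
    simp only [liftStmt, TM2.stepAux]
    exact ih _ _
  | branch f q q' ih ih' =>
    simp only [liftStmt, TM2.stepAux]
    cases f v
    · exact ih' _ _
    · exact ih _ _
  | goto f => rfl
  | halt => rfl

theorem step_liftCfg (c c' : TM2.Cfg tm.Γ tm.Λ tm.σ) (h : TM2.step tm.m c = some c') :
    step (prog := prog) code (liftCfg c) = some (liftCfg c') := by
  obtain ⟨_ | l, v, S⟩ := c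
  · simp at h
  · simp only [TM2.step, Option.some.injEq] at h
    subst h
    rw [← stepAux_liftStmt]
    rfl

end Reduction

namespace Reduction

variable {tm : FinTM2} {code : UGSymbol 2 → tm.Γ tm.k₀} {prog : List Token}

/-! #### Single transitions -/

section Step

attribute [local simp] program popWork ifTick forget pushTick write jump isTick lastSign cfg
  update_input update_count update_scratch update_var update_out workStacks_input workStacks_count
  workStacks_scratch workStacks_var workStacks_out head?_ticks_zero head?_ticks_succ
  tail_ticks_zero tail_ticks_succ tick_cons_ticks

variable (s : Fin 3 → Bool) (inp : List AndSymbol) (n t : ℕ) (a : Fin 3 → ℕ)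
  (out : List (tm.Γ tm.k₀))

theorem step_readCount_tick :
    step (prog := prog) code (cfg .readCount s (.tick :: inp) n t a out) =
      some (cfg .readCount s inp (n + 1) t a out) := by
  simp

theorem step_readCount_sep :
    step (prog := prog) code (cfg .readCount s (.sep :: inp) n t a out) =
      some (cfg (.readVar 0) s inp n t a out) := by
  simp

theorem step_readVar_tick (j : Fin 3) :
    step (prog := prog) code (cfg (.readVar j) s (.tick :: inp) n t a out) =
      some (cfg (.readVar j) s inp n t (Function.update a j (a j + 1)) out) := by
  simp

theorem step_readVar_sign (j : Fin 3) (b : Bool) :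
    step (prog := prog) code (cfg (.readVar j) s (.sign b :: inp) n t a out) =
      some (cfg (afterRead j) (Function.update s j b) inp n t a out) := by
  simp

theorem step_readVar_nil (j : Fin 3) :
    step (prog := prog) code (cfg (.readVar j) s [] n t a out) =
      some (cfg .writeCount s [] n t a (code .tick :: code .sep :: out)) := by
  simp

theorem step_exec_none (i : Fin (prog.length + 1)) (h : prog[(i : ℕ)]? = none) :
    step code (cfg (.exec i) s inp n t a out) = some (cfg (.clear 0) s inp n t a out) := by
  simp [h]

theorem step_exec_sym (i : Fin (prog.length + 1)) (f : (Fin 3 → Bool) → UGSymbol 2)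
    (h : prog[(i : ℕ)]? = some (.sym f)) : step code (cfg (.exec i) s inp n t a out) =
      some (cfg (.exec (next i)) s inp n t a (code (f s) :: out)) := by
  simp [h]

theorem step_exec_copy_succ (i : Fin (prog.length + 1)) (j : Fin 3) (x : ℕ)
    (h : prog[(i : ℕ)]? = some (.copy j)) (ha : a j = x + 1) :
    step code (cfg (.exec i) s inp n t a out) = some (cfg (.exec i) s inp n (t + 1)
      (Function.update a j x) (code .tick :: code .tick :: out)) := by
  simp [h, ha]

theorem step_exec_copy_zero (i : Fin (prog.length + 1)) (j : Fin 3)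
    (h : prog[(i : ℕ)]? = some (.copy j)) (ha : a j = 0) :
    step code (cfg (.exec i) s inp n t a out) =
      some (cfg (.restore j (next i)) s inp n t a out) := by
  simp [h, ha]
  rw [← ha, Function.update_eq_self]

theorem step_restore_succ (i : Fin (prog.length + 1)) (j : Fin 3) :
    step code (cfg (.restore j i) s inp n (t + 1) a out) =
      some (cfg (.restore j i) s inp n t (Function.update a j (a j + 1)) out) := by
  simp

theorem step_restore_zero (i : Fin (prog.length + 1)) (j : Fin 3) :
    step code (cfg (.restore j i) s inp n 0 a out) = some (cfg (.exec i) s inp n 0 a out) := by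
  simp

theorem step_clear_succ (j : Fin 3) (x : ℕ) (ha : a j = x + 1) :
    step (prog := prog) code (cfg (.clear j) s inp n t a out) =
      some (cfg (.clear j) s inp n t (Function.update a j x) out) := by
  simp [ha]

theorem step_clear_zero (j : Fin 3) (ha : a j = 0) :
    step (prog := prog) code (cfg (.clear j) s inp n t a out) =
      some (cfg (afterClear j) s inp n t a out) := by
  simp [ha]
  rw [← ha, Function.update_eq_self]

theorem step_writeCount_succ :
    step (prog := prog) code (cfg .writeCount s inp (n + 1) t a out) =
      some (cfg .writeCount s inp n t a (code .tick :: code .tick :: out)) := by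
  simp

theorem step_writeCount_zero :
    step (prog := prog) code (cfg .writeCount s [] 0 0 0 out) =
      some (liftCfg ⟨some tm.main, tm.initialState, Function.update (fun _ => []) tm.k₀ out⟩) := by
  simp [liftCfg]
  funext k
  rcases k with (_ | _ | _ | j) | k <;> simp [workStacks, ticks]

end Step

/-! #### Loops -/

theorem runsIn_readCount (s : Fin 3 → Bool) (rest : List AndSymbol) (t : ℕ) (a : Fin 3 → ℕ)
    (out : List (tm.Γ tm.k₀)) (x n : ℕ) :
    RunsIn (step (prog := prog) code) (x + 1)
      (cfg .readCount s (List.replicate x .tick ++ .sep :: rest) n t a out)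
      (cfg (.readVar 0) s rest (n + x) t a out) := by
  induction x generalizing n with
  | zero => exact .single (step_readCount_sep ..)
  | succ x ih =>
    refine .head (step_readCount_tick ..) ?_
    have := ih (n + 1)
    rwa [add_right_comm] at this

theorem runsIn_readVar (s : Fin 3 → Bool) (rest : List AndSymbol) (n t : ℕ) (j : Fin 3) (b : Bool)
    (out : List (tm.Γ tm.k₀)) (x : ℕ) (a : Fin 3 → ℕ) :
    RunsIn (step (prog := prog) code) (x + 1)
      (cfg (.readVar j) s (List.replicate x .tick ++ .sign b :: rest) n t a out)
      (cfg (afterRead j) (Function.update s j b) rest n t (Function.update a j (a j + x)) out) := by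
  induction x generalizing a with
  | zero => simpa using RunsIn.single (step_readVar_sign (code := code) s rest n t a out j b)
  | succ x ih =>
    refine .head (step_readVar_tick ..) ?_
    have := ih (Function.update a j (a j + 1))
    rwa [Function.update_idem, Function.update_self, add_right_comm] at this

/-- Copying empties the variable stack, so its ticks are saved on the scratch stack for `restore`.
Each is written twice since the copies of variable `i` have numbers `2 * i + 1` and `2 * i + 2`. -/
theorem runsIn_copy (s : Fin 3 → Bool) (inp : List AndSymbol) (n : ℕ) (j : Fin 3)
    (i : Fin (prog.length + 1)) (h : prog[(i : ℕ)]? = some (.copy j)) (x t : ℕ) (a : Fin 3 → ℕ)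
    (out : List (tm.Γ tm.k₀)) (ha : a j = x) :
    RunsIn (step code) (x + 1) (cfg (.exec i) s inp n t a out)
      (cfg (.restore j (next i)) s inp n (t + x) (Function.update a j 0)
        (List.replicate (2 * x) (code .tick) ++ out)) := by
  induction x generalizing t a out with
  | zero =>
    have := RunsIn.single (step_exec_copy_zero (code := code) s inp n t a out i j h ha)
    rw [← ha, Function.update_eq_self]
    simpa [ha] using this
  | succ x ih =>
    refine .head (step_exec_copy_succ s inp n t a out i j x h ha) ?_
    have := ih (t + 1) (Function.update a j x) (code .tick :: code .tick :: out) (by simp)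
    rw [Function.update_idem, add_right_comm] at this
    convert this using 2
    · rw [add_assoc]
    rw [show 2 * (x + 1) = 2 * x + 1 + 1 by ring]
    simp [List.replicate_succ', List.append_assoc]

theorem runsIn_restore (s : Fin 3 → Bool) (inp : List AndSymbol) (n : ℕ) (j : Fin 3)
    (i : Fin (prog.length + 1)) (out : List (tm.Γ tm.k₀)) (x : ℕ) (a : Fin 3 → ℕ) :
    RunsIn (step code) (x + 1) (cfg (.restore j i) s inp n x a out)
      (cfg (.exec i) s inp n 0 (Function.update a j (a j + x)) out) := by
  induction x generalizing a with
  | zero => simpa using RunsIn.single (step_restore_zero (code := code) s inp n a out i j)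
  | succ x ih =>
    refine .head (step_restore_succ ..) ?_
    have := ih (Function.update a j (a j + 1))
    rwa [Function.update_idem, Function.update_self, add_assoc, add_comm 1] at this

theorem runsIn_clear (s : Fin 3 → Bool) (inp : List AndSymbol) (n t : ℕ) (j : Fin 3)
    (out : List (tm.Γ tm.k₀)) (x : ℕ) (a : Fin 3 → ℕ) (ha : a j = x) :
    RunsIn (step (prog := prog) code) (x + 1) (cfg (.clear j) s inp n t a out)
      (cfg (afterClear j) s inp n t (Function.update a j 0) out) := by
  induction x generalizing a with
  | zero =>
    rw [← ha, Function.update_eq_self]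
    simpa [ha] using RunsIn.single (step_clear_zero (code := code) s inp n t a out j ha)
  | succ x ih =>
    refine .head (step_clear_succ s inp n t a out j x ha) ?_
    have := ih (Function.update a j x) (by simp)
    rwa [Function.update_idem] at this

theorem runsIn_writeCount (s : Fin 3 → Bool) (out : List (tm.Γ tm.k₀)) (n : ℕ) :
    RunsIn (step (prog := prog) code) (n + 1) (cfg .writeCount s [] n 0 0 out)
      (liftCfg ⟨some tm.main, tm.initialState, Function.update (fun _ => []) tm.k₀
        (List.replicate (2 * n) (code .tick) ++ out)⟩) := by
  induction n generalizing out with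
  | zero => simpa using RunsIn.single (step_writeCount_zero (code := code) s out)
  | succ n ih =>
    refine .head (step_writeCount_succ ..) ?_
    convert ih (code .tick :: code .tick :: out) using 3
    rw [show 2 * (n + 1) = 2 * n + 1 + 1 by ring]
    simp [List.replicate_succ', List.append_assoc]

/-- The gadget writer writes the gadget of the current clause in reverse. -/
theorem runsIn_exec (s : Fin 3 → Bool) (inp : List AndSymbol) (n : ℕ) (a : Fin 3 → ℕ) (A : ℕ)
    (hA : ∀ j, a j ≤ A) (l : List Token) (i : Fin (prog.length + 1))
    (hi : prog.drop i = l) (out : List (tm.Γ tm.k₀)) :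
    RunsIn (step code) (l.length * (2 * A + 2) + 1) (cfg (.exec i) s inp n 0 a out)
      (cfg (.clear 0) s inp n 0 a ((l.flatMap (Token.eval s a)).reverse.map code ++ out)) := by
  induction l generalizing i out with
  | nil =>
    have h : prog[(i : ℕ)]? = none := by
      rw [← List.head?_drop, hi]; rfl
    simpa using RunsIn.single (step_exec_none (code := code) s inp n 0 a out i h)
  | cons tk l ih =>
    have h : prog[(i : ℕ)]? = some tk := by
      rw [← List.head?_drop, hi]; rfl
    have hlt : (i : ℕ) < prog.length := (List.getElem?_eq_some_iff.1 h).1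
    have hnext : prog.drop (next i) = l := by
      have : (next i : ℕ) = i + 1 := by simp [next]; omega
      rw [this, ← List.tail_drop, hi, List.tail_cons]
    cases tk with
    | sym f =>
      have h1 := RunsIn.head (step_exec_sym s inp n 0 a out i f h) (ih (next i) hnext _)
      refine RunsIn.mono (m := l.length * (2 * A + 2) + 1 + 1) ?_ ?_
      · simpa [Token.eval] using h1
      · simp only [List.length_cons]; ring_nf; omega
    | copy j =>
      have h1 := runsIn_copy (code := code) s inp n j i h (a j) 0 a out rfl
      have h2 := runsIn_restore (code := code) s inp n j (next i)
        (List.replicate (2 * a j) (code .tick) ++ out) (a j) (Function.update a j 0)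
      rw [zero_add] at h1
      rw [Function.update_idem, Function.update_self, zero_add, Function.update_eq_self] at h2
      have h3 := (h1.trans h2).trans (ih (next i) hnext _)
      -- Copying and restoring take `a j + 1` steps each, together at most `2 * A + 2`.
      refine RunsIn.mono (m := (a j + 1 + (a j + 1)) + (l.length * (2 * A + 2) + 1)) ?_ ?_
      · simpa [Token.eval] using h3
      · have := hA j
        simp only [List.length_cons]
        nlinarith

end Reduction

/-! ### The reduction is computed in polynomial time -/

/-- The instructions that write an edge of the gadget in reverse. -/
def edgeTokens (e : EdgeSpec) : List Token :=
  [.sym fun s => .perm (signPerm (e.sign s)), .sym fun _ => .sep, .sym fun _ => .tick,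
    .sym fun _ => .tick, .copy e.2, .sym fun _ => .sep] ++
  e.1.elim [] fun x => [.sym fun _ => .tick, .copy x]

/-- The instructions that write a clause gadget in reverse. -/
def gadgetTokens : List Token := gadgetSpecs.flatMap edgeTokens

/-- The string of a clause. -/
def AndClause.encode {n : ℕ} (c : AndClause n) : List AndSymbol :=
  AndLiteral.encode (c 0) ++ AndLiteral.encode (c 1) ++ AndLiteral.encode (c 2)

theorem List.replicate_append_cons_self {α : Type*} (n : ℕ) (x : α) (l : List α) :
    List.replicate n x ++ x :: l = x :: (List.replicate n x ++ l) := by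
  rw [List.append_cons, ← List.replicate_succ', List.replicate_succ, List.cons_append]

/-- The fixed ticks among the instructions supply the offsets 2 and 1 of the vertex numbers; the
reference vertex has number 0 and needs none. -/
theorem flatMap_edgeTokens {n : ℕ} (c : AndClause n) (e : EdgeSpec) :
    (edgeTokens e).flatMap (Token.eval (fun j => (c j).2) fun j => (c j).1) =
      (c.edge e).encode.reverse := by
  rcases e with ⟨_ | x, y⟩ <;>
    simp [edgeTokens, Token.eval, AndClause.edge, UGEdge.encode, refVertex, fstVertex, sndVertex,
      List.replicate_succ, List.replicate_append_cons_self]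

theorem flatMap_gadgetTokens {n : ℕ} (c : AndClause n) :
    (gadgetTokens.flatMap (Token.eval (fun j => (c j).2) fun j => (c j).1)).reverse =
      (gadgetSpecs.map c.edge).reverse.flatMap UGEdge.encode := by
  rw [gadgetTokens, List.flatMap_assoc]
  simp only [flatMap_edgeTokens]
  rw [List.reverse_flatMap, ← List.map_reverse, List.flatMap_map]
  simp [Function.comp_def]

theorem AndClause.length_encode {n : ℕ} (c : AndClause n) :
    c.encode.length = ((c 0).1 : ℕ) + (c 1).1 + (c 2).1 + 3 := by
  simp [AndClause.encode, AndLiteral.encode]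
  ring

theorem AndClause.le_sum {n : ℕ} (c : AndClause n) (j : Fin 3) :
    ((c j).1 : ℕ) ≤ (c 0).1 + (c 1).1 + (c 2).1 := by
  fin_cases j <;> simp <;> omega

/-- The factor by which the reduction increases lengths and running times. -/
def reductionFactor : ℕ := 2 * gadgetTokens.length + 3

theorem AndClause.length_gadget_le {n : ℕ} (c : AndClause n) :
    ((gadgetSpecs.map c.edge).reverse.flatMap UGEdge.encode).length ≤
      reductionFactor * c.encode.length := by
  rw [← flatMap_gadgetTokens, List.length_reverse, c.length_encode, reductionFactor]
  generalize gadgetTokens = l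
  induction l with
  | nil => simp
  | cons tk l ih =>
    have : (tk.eval (fun j => (c j).2) fun j => (c j).1).length ≤
        2 * ((c 0).1 + (c 1).1 + (c 2).1 + 3) := by
      cases tk with
      | sym f => simp [Token.eval]; omega
      | copy j =>
        have := c.le_sum j
        simp [Token.eval]; omega
    simp only [List.flatMap_cons, List.length_append, List.length_cons]
    nlinarith

namespace Reduction

variable {tm : FinTM2} {code : UGSymbol 2 → tm.Γ tm.k₀}

/-- Reading, writing the gadget and clearing leave the variable stacks empty again, so clauses can
be chained. The signs left behind are irrelevant, since the next clause overwrites them. -/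
theorem runsIn_clause {n : ℕ} (c : AndClause n) (s : Fin 3 → Bool) (rest : List AndSymbol) (N : ℕ)
    (out : List (tm.Γ tm.k₀)) :
    ∃ s', RunsIn (step (prog := gadgetTokens) code) (reductionFactor * c.encode.length)
      (cfg (.readVar 0) s (c.encode ++ rest) N 0 0 out)
      (cfg (.readVar 0) s' rest N 0 0
        (((gadgetSpecs.map c.edge).reverse.flatMap UGEdge.encode).map code ++ out)) := by
  refine ⟨fun j => (c j).2, ?_⟩
  have henc : c.encode ++ rest = List.replicate ((c 0).1 : ℕ) .tick ++ .sign (c 0).2 ::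
      (List.replicate ((c 1).1 : ℕ) .tick ++ .sign (c 1).2 ::
      (List.replicate ((c 2).1 : ℕ) .tick ++ .sign (c 2).2 :: rest)) := by
    simp [AndClause.encode, AndLiteral.encode]
  rw [henc]
  have h0 := runsIn_readVar (code := code) (prog := gadgetTokens) s
    (List.replicate ((c 1).1 : ℕ) .tick ++ .sign (c 1).2 ::
      (List.replicate ((c 2).1 : ℕ) .tick ++ .sign (c 2).2 :: rest)) N 0 0 (c 0).2 out (c 0).1 0
  have h1 := runsIn_readVar (code := code) (prog := gadgetTokens) (Function.update s 0 (c 0).2)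
    (List.replicate ((c 2).1 : ℕ) .tick ++ .sign (c 2).2 :: rest) N 0 1 (c 1).2 out (c 1).1
    (Function.update (0 : Fin 3 → ℕ) 0 (0 + ((c 0).1 : ℕ)))
  have h2 := runsIn_readVar (code := code) (prog := gadgetTokens)
    (Function.update (Function.update s 0 (c 0).2) 1 (c 1).2) rest N 0 2 (c 2).2 out (c 2).1
    (Function.update (Function.update (0 : Fin 3 → ℕ) 0 (0 + ((c 0).1 : ℕ))) 1 (0 + ((c 1).1 : ℕ)))
  have hs : Function.update (Function.update (Function.update s 0 (c 0).2) 1 (c 1).2) 2 (c 2).2 =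
      fun j => (c j).2 := by
    funext j; fin_cases j <;> rfl
  have ha : Function.update (Function.update (Function.update (0 : Fin 3 → ℕ) 0 (0 + ((c 0).1 : ℕ))) 1
      (0 + ((c 1).1 : ℕ))) 2 (0 + ((c 2).1 : ℕ)) = fun j => ((c j).1 : ℕ) := by
    funext j; fin_cases j <;> simp [Function.update]
  have hx := runsIn_exec (code := code) (prog := gadgetTokens) (fun j => (c j).2) rest N
    (fun j => ((c j).1 : ℕ)) _ c.le_sum gadgetTokens 0 rfl out
  rw [flatMap_gadgetTokens] at hx
  set out' := ((gadgetSpecs.map c.edge).reverse.flatMap UGEdge.encode).map code ++ out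
  have hc0 := runsIn_clear (code := code) (prog := gadgetTokens) (fun j => (c j).2) rest N 0 0
    out' (c 0).1 (fun j => ((c j).1 : ℕ)) rfl
  have hc1 := runsIn_clear (code := code) (prog := gadgetTokens) (fun j => (c j).2) rest N 0 1
    out' (c 1).1 (Function.update (fun j => ((c j).1 : ℕ)) 0 0) rfl
  have hc2 := runsIn_clear (code := code) (prog := gadgetTokens) (fun j => (c j).2) rest N 0 2
    out' (c 2).1 (Function.update (Function.update (fun j => ((c j).1 : ℕ)) 0 0) 1 0) rfl
  have hz : Function.update (Function.update (Function.update (fun j => ((c j).1 : ℕ)) 0 0) 1 0)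
      2 0 = 0 := by
    funext j; fin_cases j <;> rfl
  rw [hz] at hc2
  -- Each variable is read onto an empty stack, so the value added to is 0 by computation.
  change RunsIn _ _ _ (cfg _ _ _ _ _ (Function.update (Function.update (Function.update
    (0 : Fin 3 → ℕ) 0 (0 + ((c 0).1 : ℕ))) 1 (0 + ((c 1).1 : ℕ))) 2 (0 + ((c 2).1 : ℕ))) _) at h2
  rw [hs, ha] at h2
  refine ((((((h0.trans h1).trans h2).trans hx).trans hc0).trans hc1).trans hc2).mono ?_
  rw [c.length_encode, reductionFactor]
  ring_nf
  omega

theorem runsIn_clauses {n : ℕ} (l : List (AndClause n)) (s : Fin 3 → Bool) (N : ℕ)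
    (out : List (tm.Γ tm.k₀)) :
    ∃ s', RunsIn (step (prog := gadgetTokens) code)
      (reductionFactor * (l.flatMap AndClause.encode).length)
      (cfg (.readVar 0) s (l.flatMap AndClause.encode) N 0 0 out)
      (cfg (.readVar 0) s' [] N 0 0 (((l.flatMap fun c => gadgetSpecs.map c.edge).reverse.flatMap
        UGEdge.encode).map code ++ out)) := by
  induction l generalizing s out with
  | nil => exact ⟨s, .refl _ _⟩
  | cons c l ih =>
    obtain ⟨s₁, h₁⟩ := runsIn_clause (code := code) c s (l.flatMap AndClause.encode) N out
    obtain ⟨s₂, h₂⟩ := ih s₁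
      (((gadgetSpecs.map c.edge).reverse.flatMap UGEdge.encode).map code ++ out)
    refine ⟨s₂, ?_⟩
    have h := (h₁.trans h₂).mono (m' := reductionFactor *
      ((c :: l).flatMap AndClause.encode).length) (by
        rw [List.flatMap_cons, List.length_append, mul_add])
    simpa only [List.flatMap_cons, List.reverse_append, List.flatMap_append, List.map_append,
      List.append_assoc] using h

theorem encode_eq (φ : AndFormula) : φ.encode =
    List.replicate φ.numVars .tick ++ .sep :: φ.clauses.flatMap AndClause.encode := rfl

theorem runsIn_reduction (φ : AndFormula) :
    RunsIn (step (prog := gadgetTokens) code) (reductionFactor * φ.encode.length)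
      (cfg .readCount (fun _ => false) φ.encode 0 0 0 [])
      (liftCfg ⟨some tm.main, tm.initialState,
        Function.update (fun _ => []) tm.k₀ (φ.toUG.encode.map code)⟩) := by
  obtain ⟨s, h⟩ := runsIn_clauses (code := code) φ.clauses (fun _ => false) (0 + φ.numVars) []
  have h₀ := runsIn_readCount (code := code) (prog := gadgetTokens) (fun _ => false)
    (φ.clauses.flatMap AndClause.encode) 0 0 [] φ.numVars 0
  have h₁ := RunsIn.head (step_readVar_nil (code := code) (prog := gadgetTokens) s (0 + φ.numVars)
    0 0 (((φ.clauses.flatMap fun c => gadgetSpecs.map c.edge).reverse.flatMap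
      UGEdge.encode).map code ++ []) 0) (runsIn_writeCount s _ (0 + φ.numVars))
  have henc : φ.toUG.encode.map code = List.replicate (2 * (0 + φ.numVars)) (code .tick) ++
      code .tick :: code .sep :: (((φ.clauses.flatMap fun c => gadgetSpecs.map c.edge).reverse.flatMap
        UGEdge.encode).map code ++ []) := by
    simp [UGInstance.encode, AndFormula.toUG, List.replicate_succ', List.map_flatMap]
  rw [henc]
  refine ((h₀.trans h).trans h₁).mono ?_
  rw [encode_eq, reductionFactor]
  simp only [List.length_append, List.length_replicate, List.length_cons]
  ring_nf
  nlinarith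

/-- The time bound of the second machine is a polynomial in the length of its own input, which this
compares with the length of the formula. -/
theorem length_encode_toUG_le (φ : AndFormula) :
    φ.toUG.encode.length ≤ reductionFactor * φ.encode.length := by
  have h : ((φ.clauses.flatMap fun c => gadgetSpecs.map c.edge).reverse.flatMap
      UGEdge.encode).length ≤ reductionFactor * (φ.clauses.flatMap AndClause.encode).length := by
    generalize φ.clauses = l
    induction l with
    | nil => simp
    | cons c l ih =>
      have := c.length_gadget_le
      simp only [List.flatMap_cons, List.reverse_append, List.flatMap_append, List.length_append]
      nlinarith
  rw [encode_eq]
  simp only [UGInstance.encode, AndFormula.toUG, List.length_append, List.length_replicate,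
    List.length_cons]
  have : 3 ≤ reductionFactor := by simp [reductionFactor]
  nlinarith

end Reduction

/-! ### The combined machine as a decision procedure -/

theorem Polynomial.eval_mono_nat (p : Polynomial ℕ) {x y : ℕ} (h : x ≤ y) :
    p.eval x ≤ p.eval y := by
  simp only [Polynomial.eval_eq_sum, Polynomial.sum]
  gcongr

namespace Reduction

theorem initList_machine (tm : FinTM2) (code : UGSymbol 2 → tm.Γ tm.k₀) (prog : List Token)
    (l : List AndSymbol) : initList (machine tm code prog) l =
      cfg (tm := tm) (prog := prog) .readCount (fun _ => false) l 0 0 0 [] := by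
  refine congrArg (TM2.Cfg.mk _ _) ?_
  funext k
  rcases k with (_ | _ | _ | j) | k <;> simp [machine, workStacks, ticks]; rfl

theorem liftCfg_initList (tm : FinTM2) (prog : List Token) (l : List (tm.Γ tm.k₀)) :
    liftCfg (prog := prog) (initList tm l) =
      liftCfg ⟨some tm.main, tm.initialState, Function.update (fun _ => []) tm.k₀ l⟩ := by
  refine congrArg liftCfg (congrArg (TM2.Cfg.mk _ _) ?_)
  funext k
  by_cases h : k = tm.k₀
  · subst h; simp
  · simp [h]

/-- A halting configuration has all stacks empty except the output, and the work stacks are empty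
throughout the simulation. -/
theorem haltList_machine (tm : FinTM2) (code : UGSymbol 2 → tm.Γ tm.k₀) (prog : List Token)
    (l : List (tm.Γ tm.k₁)) :
    haltList (machine tm code prog) l = liftCfg (prog := prog) (haltList tm l) := by
  refine congrArg (TM2.Cfg.mk _ _) ?_
  funext k
  rcases k with k | k
  · rfl
  · by_cases h : k = tm.k₁
    · subst h; simp [machine, haltList]; rfl
    · simp [machine, haltList, h]

end Reduction

open Reduction in
/-- The polynomial time algorithms for Unique Games with two labels give polynomial time algorithms
for formulas. -/
theorem DecidedInPolyTime.comp_toUG {B : UGInstance 2 → Bool}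
    (hB : DecidedInPolyTime UGInstance.encode B) :
    DecidedInPolyTime AndFormula.encode fun φ => B φ.toUG := by
  obtain ⟨h⟩ := hB
  refine ⟨⟨⟨machine h.tm h.inputAlphabet.symm gadgetTokens, Equiv.refl AndSymbol,
    h.outputAlphabet⟩, Polynomial.C reductionFactor * Polynomial.X +
      h.time.comp (Polynomial.C reductionFactor * Polynomial.X), fun φ => Classical.choice ?_⟩⟩
  have h₁ := runsIn_reduction (code := h.inputAlphabet.symm) φ
  have h₂ : RunsIn (step (prog := gadgetTokens) h.inputAlphabet.symm) _ _ _ :=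
    RunsIn.map liftCfg (step_liftCfg h.inputAlphabet.symm) ⟨h.outputsFun φ.toUG⟩
  rw [liftCfg_initList] at h₂
  have h₃ := (h₁.trans h₂).mono (m' := (Polynomial.C reductionFactor * Polynomial.X +
      h.time.comp (Polynomial.C reductionFactor * Polynomial.X)).eval φ.encode.length) (by
    simp only [Polynomial.eval_add, Polynomial.eval_mul, Polynomial.eval_C, Polynomial.eval_X,
      Polynomial.eval_comp]
    exact Nat.add_le_add_left (h.time.eval_mono_nat (length_encode_toUG_le φ)) _)
  rw [← initList_machine h.tm h.inputAlphabet.symm, ← haltList_machine h.tm h.inputAlphabet.symm]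
    at h₃
  -- The machine receives `φ.encode` mapped through the identity of the alphabet; a variable `l`
  -- allows substitution along that equality.
  have hinput (l : List AndSymbol) (hl : l = φ.encode) : Nonempty (TM2OutputsInTime
      (machine h.tm h.inputAlphabet.symm gadgetTokens) l (some (List.map h.outputAlphabet.invFun
        (Computability.encodeBool (B φ.toUG)))) ((Polynomial.C reductionFactor * Polynomial.X +
      h.time.comp (Polynomial.C reductionFactor * Polynomial.X)).eval φ.encode.length)) := by
    subst hl
    exact h₃
  exact hinput _ (List.map_id _)

/-! ### The hardness theorem -/

theorem theorem2 (β γ : ℝ) (hγ : 0 < γ) (hγβ : γ < β) (hβ : β < 1 / 2)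
    (hconj : UnbalancedAndConjecture β γ) (ε : ℝ) (hε : 0 ≤ ε) :
    MinUGApproxHard ((β + γ - 2 * β * γ) / 2) ((1 - (1 - β) ^ 3) / 4 - ε) := by
  refine ⟨2, by norm_num, fun η hη => ?_⟩
  rintro ⟨B, hB, hhigh, hlow⟩
  obtain ⟨Δ₀, hΔ₀⟩ := hconj η hη
  -- The soundness loss is `δ / 4 ≤ η / 2 < η`; the cap at 1 is needed for the Chernoff bound.
  set δ := min (2 * η) 1 with hδ
  have hδ0 : 0 < δ := lt_min (by linarith) one_pos
  obtain ⟨Δ₁, hΔ₁⟩ := exists_nat_ge (4 / δ ^ 2)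
  have hedges (φ : AndFormula) (hφ : φ.clauses ≠ []) : φ.toUG.edges ≠ [] := by
    rw [← List.length_pos_iff, φ.length_toUG_edges]
    exact Nat.mul_pos (by norm_num) (List.length_pos_iff.2 hφ)
  have hne (φ : AndFormula) (hn : 1 ≤ φ.numVars)
      (hlen : φ.clauses.length = (Δ₀ + Δ₁ + 1) * φ.numVars) : φ.clauses ≠ [] := by
    rw [← List.length_pos_iff, hlen]
    positivity
  -- `Δ₀` serves the conjecture, `Δ₁` the concentration bound, and the 1 ensures that there is a
  -- clause.
  refine hΔ₀ (Δ₀ + Δ₁ + 1) (by omega) ⟨fun φ => B φ.toUG, hB.comp_toUG, ?_, ?_⟩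
  · refine eventually_half_lt_randomFormulaProb (by linarith) hβ.le hδ0.le (min_le_right _ _) ?_ ?_
    · rw [div_le_iff₀ (by positivity)] at hΔ₁
      refine hΔ₁.trans ?_
      gcongr
      omega
    · intro φ hn hlen hsat
      have hφ := hne φ hn hlen
      refine hhigh _ (hedges φ hφ) (lt_of_lt_of_le ?_ (φ.le_minValue_toUG hφ hsat))
      have : δ ≤ 2 * η := min_le_left _ _
      linarith
  · intro φ hn hlen hsat
    have hφ := hne φ hn hlen
    -- Here `(1 - t) / 3` is the claimed value `α / 2` plus `η / 3`, below `α / 2 + η`.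
    refine hlow _ (hedges φ hφ) (lt_of_le_of_lt (φ.minValue_toUG_le hφ hsat) ?_)
    linarith
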